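/- Let $M$ be a finitely generated abelian group and let $A=\bigoplus_{m\in M}A_m$ be a commutative $M$-graded ring. A family $f$ of non-zero homogeneous elements of $A$ is called relevant if for every $x\in M$ there is an integer $n>0$ such that $nx$ lies in the subgroup of $M$ generated by the degrees of the homogeneous divisors of the elements of $f$. Let $\mathcal F_A$ be the set of finite relevant families of $A$ (regarded as finite subsets of $A$). For $f\in\mathcal F_A$ let $A_{(f)}$ (the potion of $A$ relative to $f$) be the degree-zero part of the localization of $A$ at the multiplicative subset generated by $f$, and let $U_f=\operatorname{Spec}A_{(f)}$. Let $\operatorname{Proj}(A)$ be the scheme obtained by gluing the $U_f$, $f\in\mathcal F_A$, along the open subschemes $U_{f\cup g}\subset U_f$ and $U_{f\cup g}\subset U_g$. **Proposition (Base change).** Let $R\to A_0$ and $R\to R'$ be ring maps, and give $A\otimes_R R'$ the $M$-grading with components $A_m\otimes_R R'$, so that $\operatorname{Proj}(A)$ is an $R$-scheme and $\operatorname{Proj}(A\otimes_R R')$ is an $R'$-scheme. Then there is an isomorphism of schemes over $\operatorname{Spec}(R')$ $$\operatorname{Proj}(A\otimes_R R')\;\cong\;\operatorname{Proj}(A)\times_{\operatorname{Spec}(R)}\operatorname{Spec}(R').$$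 This isomorphism is compatible with the canonical charts: whenever $f\in\mathcal F_A$ and $f\otimes1=\{a\otimes 1: a\in f\}$ belongs to $\mathcal F_{A\otimes_R R'}$, its composition with the projection to $\operatorname{Proj}(A)$ restricts on $U_{f\otimes 1}$ to the morphism $U_{f\otimes 1}\to U_f\subset\operatorname{Proj}(A)$ induced by $A_{(f)}\to(A\otimes_R R')_{(f\otimes1)}$. -/

import Mathlib

open CategoryTheory CategoryTheory.Limits AlgebraicGeometry
open scoped TensorProduct

universe u

noncomputable section

namespace MultiProj

variable {M A σ : Type u} [AddCommGroup M] [DecidableEq M] [CommRing A] [SetLike σ A]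
  [AddSubgroupClass σ A] (𝒜 : M → σ) [GradedRing 𝒜]

/-- The group of degrees generated by a set `f` of elements of `A`: the subgroup of `M` generated
by the degrees of the (nonzero, homogeneous) elements of `f`. -/
def degreeGroup (f : Set A) : AddSubgroup M :=
  AddSubgroup.closure {m | ∃ a ∈ f, a ≠ 0 ∧ a ∈ 𝒜 m}

/-- The set of the homogeneous divisors of the elements of `f`. -/
def homogeneousDivisors (f : Set A) : Set A :=
  {b | b ≠ 0 ∧ SetLike.IsHomogeneousElem 𝒜 b ∧ ∃ a ∈ f, b ∣ a}

/-- A set `f` of homogeneous elements is relevant if every `x : M` has a positive multiple in the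
group of degrees generated by the homogeneous divisors of the elements of `f`. -/
def IsRelevant (f : Set A) : Prop :=
  ∀ x : M, ∃ n : ℕ, 0 < n ∧ n • x ∈ degreeGroup 𝒜 (homogeneousDivisors 𝒜 f)

/-- The finite relevant families of (nonzero) homogeneous elements of `A`. -/
@[ext]
structure FiniteRelevantFamily where
  carrier : Set A
  finite : carrier.Finite
  ne_zero : ∀ a ∈ carrier, a ≠ 0
  homogeneous : ∀ a ∈ carrier, SetLike.IsHomogeneousElem 𝒜 a
  relevant : IsRelevant 𝒜 carrier

/-- The potion `A_(f)`: the degree zero part of the localization of `A` at the multiplicative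
subset generated by `f`. -/
abbrev Potion (f : Set A) : Type u :=
  HomogeneousLocalization 𝒜 (Submonoid.closure f)

/-- The canonical morphism of potions `A_(f) → A_(g)`, for `f ⊆ g`. -/
def potionMap {f g : Set A} (h : f ⊆ g) : Potion 𝒜 f →+* Potion 𝒜 g :=
  HomogeneousLocalization.mapId 𝒜 (Submonoid.closure_mono h)

section Algebra

variable {𝒜}

lemma val_potionMap_mk {f g : Set A} (h : f ⊆ g) {i : M} {a q : A} (ha : a ∈ 𝒜 i) (hq : q ∈ 𝒜 i)
    (hqf : q ∈ Submonoid.closure f) :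
    (potionMap 𝒜 h (HomogeneousLocalization.mk ⟨i, ⟨a, ha⟩, ⟨q, hq⟩, hqf⟩)).val =
      Localization.mk a ⟨q, Submonoid.closure_mono h hqf⟩ :=
  rfl

lemma potionMap_comp {f g h : Set A} (hfg : f ⊆ g) (hgh : g ⊆ h) :
    (potionMap 𝒜 hgh).comp (potionMap 𝒜 hfg) = potionMap 𝒜 (hfg.trans hgh) := by
  ext x
  obtain ⟨c, rfl⟩ := x.mk_surjective
  rfl

lemma exists_homogeneous_cofactor {a b : A} {i j : M} (ha : a ∈ 𝒜 i) (hb : b ∈ 𝒜 j)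
    (h : a ∣ b) : ∃ c ∈ 𝒜 (j - i), b = a * c := by
  obtain ⟨c, rfl⟩ := h
  refine ⟨(DirectSum.decompose 𝒜 c (j - i) : A), SetLike.coe_mem _, ?_⟩
  rw [← DirectSum.coe_decompose_mul_add_of_left_mem 𝒜 ha, add_sub_cancel,
    DirectSum.decompose_of_mem_same 𝒜 hb]

lemma isHomogeneousElem_of_mem_closure {f : Set A}
    (hf : ∀ a ∈ f, SetLike.IsHomogeneousElem 𝒜 a) {z : A} (hz : z ∈ Submonoid.closure f) :
    SetLike.IsHomogeneousElem 𝒜 z :=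
  (Submonoid.closure_le (S := SetLike.homogeneousSubmonoid 𝒜)).mpr hf hz

lemma exists_degree_quotient {f : Set A} {k : M}
    (hk : k ∈ degreeGroup 𝒜 (homogeneousDivisors 𝒜 f)) :
    ∃ i, ∃ e ∈ 𝒜 i, ∃ w ∈ 𝒜 (k + i),
      (∃ z ∈ Submonoid.closure f, e ∣ z) ∧ ∃ z ∈ Submonoid.closure f, w ∣ z := by
  unfold degreeGroup at hk
  induction hk using AddSubgroup.closure_induction with
  | mem m hm =>
    obtain ⟨b, ⟨-, -, a, ha, hba⟩, -, hb⟩ := hm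
    exact ⟨0, 1, SetLike.one_mem_graded 𝒜, b, by simpa using hb, ⟨1, one_mem _, dvd_rfl⟩,
      a, Submonoid.subset_closure ha, hba⟩
  | zero =>
    exact ⟨0, 1, SetLike.one_mem_graded 𝒜, 1, by simpa using SetLike.one_mem_graded 𝒜,
      ⟨1, one_mem _, dvd_rfl⟩, 1, one_mem _, dvd_rfl⟩
  | add x y _ _ hx hy =>
    obtain ⟨i, e, he, w, hw, ⟨z, hz, hez⟩, ⟨z', hz', hwz⟩⟩ := hx
    obtain ⟨i', e', he', w', hw', ⟨y, hy, hey⟩, ⟨y', hy', hwy⟩⟩ := hy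
    refine ⟨i + i', e * e', SetLike.mul_mem_graded he he', w * w', ?_,
      ⟨z * y, mul_mem hz hy, mul_dvd_mul hez hey⟩, z' * y', mul_mem hz' hy', mul_dvd_mul hwz hwy⟩
    convert! SetLike.mul_mem_graded hw hw' using 2
    abel
  | neg x _ hx =>
    obtain ⟨i, e, he, w, hw, h1, h2⟩ := hx
    exact ⟨x + i, w, hw, e, by simpa using he, h2, h1⟩

/-- For `f` relevant and `g` finite, the degree zero fraction whose inversion turns `A_(f)` into
`A_(f ∪ g)`. -/
lemma exists_fraction {f g : Set A} (hf : ∀ a ∈ f, SetLike.IsHomogeneousElem 𝒜 a)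
    (hrel : IsRelevant 𝒜 f) (hg : ∀ a ∈ g, SetLike.IsHomogeneousElem 𝒜 a) (hfin : g.Finite) :
    ∃ d, ∃ x ∈ 𝒜 d, ∃ z ∈ 𝒜 d, z ∈ Submonoid.closure f ∧
      (∃ y ∈ Submonoid.closure (f ∪ g), x ∣ y) ∧ ∀ b ∈ g, b ∣ x := by
  classical
  set β : A := ∏ b ∈ hfin.toFinset, b with hβ
  have hβg : β ∈ Submonoid.closure g :=
    Submonoid.prod_mem _ fun b hb ↦ Submonoid.subset_closure (by simpa using hb)
  obtain ⟨m, hm⟩ := isHomogeneousElem_of_mem_closure hg hβg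
  obtain ⟨n, hn, hnm⟩ := hrel m
  obtain ⟨i, e, he, w, hw, ⟨y, hy, hey⟩, ⟨z, hz, hwz⟩⟩ := exists_degree_quotient hnm
  obtain ⟨j, hj⟩ := isHomogeneousElem_of_mem_closure hf hz
  obtain ⟨c, hc, hzc⟩ := exists_homogeneous_cofactor hw hj hwz
  refine ⟨j, β ^ n * e * c, ?_, z, hj, hz, ⟨β ^ n * y * z, ?_, ?_⟩, fun b hb ↦ ?_⟩
  · convert! SetLike.mul_mem_graded (SetLike.mul_mem_graded (SetLike.pow_mem_graded n hm) he) hc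
      using 2
    abel
  · exact mul_mem (mul_mem (pow_mem (Submonoid.closure_mono Set.subset_union_right hβg) n)
      (Submonoid.closure_mono Set.subset_union_left hy))
      (Submonoid.closure_mono Set.subset_union_left hz)
  · exact mul_dvd_mul (mul_dvd_mul dvd_rfl hey) ⟨w, by rw [hzc, mul_comm]⟩
  · have hb' : b ∣ β := Finset.dvd_prod_of_mem (fun b ↦ b) (by simpa using hb)
    exact ((hb'.trans (dvd_pow_self β hn.ne')).mul_right e).mul_right c

lemma isLocalization_potionMap {h g : Set A} {d : M} {x z : A}
    (hh : ∀ a ∈ h, SetLike.IsHomogeneousElem 𝒜 a) (hg : ∀ a ∈ g, SetLike.IsHomogeneousElem 𝒜 a)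
    (hx : x ∈ 𝒜 d) (hz : z ∈ 𝒜 d) (hzh : z ∈ Submonoid.closure h)
    (hxy : ∃ y ∈ Submonoid.closure (h ∪ g), x ∣ y) (hgx : ∀ b ∈ g, b ∣ x) {k : Set A}
    (hk : k = h ∪ g) (hhk : h ⊆ k) :
    @IsLocalization.Away _ _ (HomogeneousLocalization.mk ⟨d, ⟨x, hx⟩, ⟨z, hz⟩, hzh⟩ : Potion 𝒜 h)
      (Potion 𝒜 k) _ (potionMap 𝒜 hhk).toAlgebra := by
  subst hk
  let := (potionMap 𝒜 hhk).toAlgebra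
  have hhom : ∀ a ∈ h ∪ g, SetLike.IsHomogeneousElem 𝒜 a := by
    rintro a (ha | ha)
    exacts [hh a ha, hg a ha]
  have hdvd : ∀ q ∈ Submonoid.closure (h ∪ g), ∃ (n : ℕ) (w : A), w ∈ Submonoid.closure h ∧
      q ∣ w * x ^ n := by
    intro q hq
    induction hq using Submonoid.closure_induction with
    | mem q hq =>
      rcases hq with hq | hq
      · exact ⟨0, q, Submonoid.subset_closure hq, by simp⟩
      · exact ⟨1, 1, one_mem _, by simpa using hgx q hq⟩
    | one => exact ⟨0, 1, one_mem _, by simp⟩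
    | mul p q _ _ hp hq =>
      obtain ⟨n, w, hw, hn⟩ := hp
      obtain ⟨n', w', hw', hn'⟩ := hq
      refine ⟨n + n', w * w', mul_mem hw hw', (mul_dvd_mul hn hn').trans ?_⟩
      exact dvd_of_eq (by ring)
  constructor; constructor
  · rintro ⟨_, n, rfl⟩
    obtain ⟨y, hy, hxy⟩ := hxy
    obtain ⟨j, hj⟩ := isHomogeneousElem_of_mem_closure hhom hy
    obtain ⟨c, hc, rfl⟩ := exists_homogeneous_cofactor hx hj hxy
    rw [map_pow]
    refine (isUnit_iff_exists_inv.mpr ⟨HomogeneousLocalization.mk ⟨j, ⟨z * c, ?_⟩, ⟨x * c, hj⟩, hy⟩,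
      ?_⟩).pow _
    · convert! SetLike.mul_mem_graded hz hc using 2
      abel
    · ext
      simp only [RingHom.algebraMap_toAlgebra, val_potionMap_mk,
        HomogeneousLocalization.val_mul, HomogeneousLocalization.val_mk,
        HomogeneousLocalization.val_one, Localization.mk_mul]
      rw [← Localization.mk_one, Localization.mk_eq_mk_iff, Localization.r_iff_exists]
      refine ⟨1, ?_⟩
      simp only [OneMemClass.coe_one, one_mul, Submonoid.coe_mul, mul_one]
      ring
  · intro p
    obtain ⟨⟨i, ⟨a, ha⟩, ⟨q, hq⟩, hqm⟩, rfl⟩ := HomogeneousLocalization.mk_surjective p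
    obtain ⟨n, w, hw, hn⟩ := hdvd q hqm
    obtain ⟨j, hj⟩ := isHomogeneousElem_of_mem_closure hh hw
    obtain ⟨c, hc, hqc⟩ := exists_homogeneous_cofactor hq
      (SetLike.mul_mem_graded hj (SetLike.pow_mem_graded n hx)) hn
    refine ⟨⟨HomogeneousLocalization.mk ⟨j + n • d, ⟨a * c, ?_⟩, ⟨w * z ^ n,
      SetLike.mul_mem_graded hj (SetLike.pow_mem_graded n hz)⟩, mul_mem hw (pow_mem hzh n)⟩,
      ⟨_, n, rfl⟩⟩, ?_⟩
    · convert! SetLike.mul_mem_graded ha hc using 2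
      abel
    · ext
      simp only [RingHom.algebraMap_toAlgebra, val_potionMap_mk, map_pow,
        HomogeneousLocalization.val_mul, HomogeneousLocalization.val_mk,
        HomogeneousLocalization.val_pow, Localization.mk_mul, Localization.mk_pow]
      rw [Localization.mk_eq_mk_iff, Localization.r_iff_exists]
      refine ⟨1, ?_⟩
      simp only [OneMemClass.coe_one, one_mul, Submonoid.coe_mul, SubmonoidClass.coe_pow]
      linear_combination (z ^ n * a) * hqc
  · intro a b hab
    obtain ⟨⟨i, ⟨a, ha⟩, ⟨q, hq⟩, hqm⟩, rfl⟩ := HomogeneousLocalization.mk_surjective a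
    obtain ⟨⟨j, ⟨b, hb⟩, ⟨r, hr⟩, hrm⟩, rfl⟩ := HomogeneousLocalization.mk_surjective b
    replace hab := congr_arg HomogeneousLocalization.val hab
    simp only [RingHom.algebraMap_toAlgebra, val_potionMap_mk,
      Localization.mk_eq_mk_iff, Localization.r_iff_exists] at hab
    obtain ⟨⟨t, ht⟩, hc⟩ := hab
    obtain ⟨n, w, hw, v, hv⟩ := hdvd t ht
    refine ⟨⟨_, n, rfl⟩, ?_⟩
    ext
    simp only [HomogeneousLocalization.val_mul, HomogeneousLocalization.val_pow,
      HomogeneousLocalization.val_mk, Localization.mk_pow, Localization.mk_mul,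
      Localization.mk_eq_mk_iff, Localization.r_iff_exists, Submonoid.coe_mul,
      SubmonoidClass.coe_pow, Subtype.exists, exists_prop]
    refine ⟨w, hw, ?_⟩
    linear_combination (z ^ n * r * a - z ^ n * q * b) * hv + (z ^ n * v) * hc

end Algebra

/-- The affine scheme `U_f`, the spectrum of the potion `A_(f)`. -/
abbrev chart (f : Set A) : Scheme.{u} :=
  Spec (CommRingCat.of (Potion 𝒜 f))

/-- The morphism `U_g ⟶ U_f` dual to the morphism of potions `A_(f) → A_(g)`, for `f ⊆ g`. -/
def chartMap {f g : Set A} (h : f ⊆ g) : chart 𝒜 g ⟶ chart 𝒜 f :=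
  Spec.map (CommRingCat.ofHom (potionMap 𝒜 h))

@[simp]
lemma chartMap_id {f : Set A} (h : f ⊆ f) : chartMap 𝒜 h = 𝟙 _ := by
  have : potionMap 𝒜 h = RingHom.id _ := HomogeneousLocalization.map_id 𝒜 _
  rw [chartMap, this]
  exact Spec.map_id _

@[simp]
lemma chartMap_comp {f g h : Set A} (hfg : f ⊆ g) (hgh : g ⊆ h) :
    chartMap 𝒜 hgh ≫ chartMap 𝒜 hfg = chartMap 𝒜 (hfg.trans hgh) := by
  rw [chartMap, chartMap, chartMap, ← Spec.map_comp, ← CommRingCat.ofHom_comp]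
  rw [potionMap_comp]

@[simp]
lemma chartMap_comp_assoc {f g h : Set A} (hfg : f ⊆ g) (hgh : g ⊆ h) {Z : Scheme.{u}}
    (k : chart 𝒜 f ⟶ Z) :
    chartMap 𝒜 hgh ≫ chartMap 𝒜 hfg ≫ k = chartMap 𝒜 (hfg.trans hgh) ≫ k := by
  rw [← Category.assoc, chartMap_comp]

section Charts

variable {𝒜}

/-- `U_(f ∪ g)` is an open subscheme of `U_f`. -/
lemma isOpenImmersion_chartMap {f g : Set A} (hf : ∀ a ∈ f, SetLike.IsHomogeneousElem 𝒜 a)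
    (hrel : IsRelevant 𝒜 f) (hg : ∀ a ∈ g, SetLike.IsHomogeneousElem 𝒜 a) (hfin : g.Finite)
    (h : f ⊆ f ∪ g) : IsOpenImmersion (chartMap 𝒜 h) := by
  obtain ⟨d, x, hx, z, hz, hzf, hxy, hgx⟩ := exists_fraction hf hrel hg hfin
  let := (potionMap 𝒜 h).toAlgebra
  have := isLocalization_potionMap hf hg hx hz hzf hxy hgx rfl h
  exact IsOpenImmersion.of_isLocalization
    (HomogeneousLocalization.mk ⟨d, ⟨x, hx⟩, ⟨z, hz⟩, hzf⟩ : Potion 𝒜 f)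

/-- The intersection of `U_(f ∪ g)` and `U_(f ∪ k)` in `U_f` is `U_(f ∪ g ∪ k)`. -/
lemma isPullback_chartMap {f g k l : Set A} (hf : ∀ a ∈ f, SetLike.IsHomogeneousElem 𝒜 a)
    (hrel : IsRelevant 𝒜 f) (hg : ∀ a ∈ g, SetLike.IsHomogeneousElem 𝒜 a) (hfin : g.Finite)
    (hk : ∀ a ∈ k, SetLike.IsHomogeneousElem 𝒜 a) (hl : l = f ∪ g ∪ k)
    (h₁ : f ∪ g ⊆ l) (h₂ : f ∪ k ⊆ l) (h₃ : f ⊆ f ∪ g) (h₄ : f ⊆ f ∪ k) :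
    IsPullback (chartMap 𝒜 h₁) (chartMap 𝒜 h₂) (chartMap 𝒜 h₃) (chartMap 𝒜 h₄) := by
  obtain ⟨d, x, hx, z, hz, hzf, ⟨y, hy, hxy⟩, hgx⟩ := exists_fraction hf hrel hg hfin
  let s : Potion 𝒜 f := HomogeneousLocalization.mk ⟨d, ⟨x, hx⟩, ⟨z, hz⟩, hzf⟩
  have hl' : l = (f ∪ k) ∪ g := by rw [hl]; ac_rfl
  have hfk : ∀ a ∈ f ∪ k, SetLike.IsHomogeneousElem 𝒜 a := by
    rintro a (ha | ha)
    exacts [hf a ha, hk a ha]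
  let := (potionMap 𝒜 h₃).toAlgebra
  let := (potionMap 𝒜 h₂).toAlgebra
  have i₁ : IsLocalization.Away s (Potion 𝒜 (f ∪ g)) :=
    isLocalization_potionMap hf hg hx hz hzf ⟨y, hy, hxy⟩ hgx rfl h₃
  have i₂ : IsLocalization.Away (potionMap 𝒜 h₄ s) (Potion 𝒜 l) :=
    isLocalization_potionMap hfk hg hx hz (Submonoid.closure_mono h₄ hzf)
      ⟨y, Submonoid.closure_mono (Set.union_subset_union_left g h₄) hy, hxy⟩ hgx hl' h₂
  have i₃ : IsLocalization ((Submonoid.powers s).map (potionMap 𝒜 h₄)) (Potion 𝒜 l) := by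
    rw [Submonoid.map_powers]
    exact i₂
  have H : (potionMap 𝒜 h₁).comp (algebraMap (Potion 𝒜 f) (Potion 𝒜 (f ∪ g))) =
      (algebraMap (Potion 𝒜 (f ∪ k)) (Potion 𝒜 l)).comp (potionMap 𝒜 h₄) := by
    simp only [RingHom.algebraMap_toAlgebra, potionMap_comp]
  exact (isPullback_SpecMap_of_isPushout _ _ _ _
    (CommRingCat.isPushout_of_isLocalization (potionMap 𝒜 h₄) (potionMap 𝒜 h₁) H
      (Submonoid.powers s))).flip

namespace FiniteRelevantFamily

variable (f g k : FiniteRelevantFamily 𝒜)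

instance isOpenImmersion_f :
    IsOpenImmersion
      (chartMap 𝒜 (Set.subset_union_left : f.carrier ⊆ f.carrier ∪ g.carrier)) :=
  isOpenImmersion_chartMap f.homogeneous f.relevant g.homogeneous g.finite _

lemma isPullback :
    IsPullback
      (chartMap 𝒜 (Set.subset_union_left : f.carrier ∪ g.carrier ⊆ f.carrier ∪ g.carrier ∪ k.carrier))
      (chartMap 𝒜 (Set.union_subset_union_left k.carrier
        (Set.subset_union_left : f.carrier ⊆ f.carrier ∪ g.carrier)))
      (chartMap 𝒜 (Set.subset_union_left : f.carrier ⊆ f.carrier ∪ g.carrier))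
      (chartMap 𝒜 (Set.subset_union_left : f.carrier ⊆ f.carrier ∪ k.carrier)) :=
  isPullback_chartMap f.homogeneous f.relevant g.homogeneous g.finite k.homogeneous rfl _ _ _ _

end FiniteRelevantFamily

end Charts

/-- The gluing data of `Proj A`: the affine schemes `U_f`, for `f` a finite relevant family, glued
along their open subschemes `U_(f ∪ g) = U_(g ∪ f)`. -/
def glueData : Scheme.GlueData.{u} where
  J := FiniteRelevantFamily 𝒜
  U f := chart 𝒜 f.carrier
  V p := chart 𝒜 (p.1.carrier ∪ p.2.carrier)
  f f g := chartMap 𝒜 Set.subset_union_left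
  f_mono f g := inferInstance
  f_hasPullback f g k := inferInstance
  f_id f := ⟨chartMap 𝒜 (Set.union_self _).subset, by simp, by simp⟩
  t f g := chartMap 𝒜 (Set.union_comm _ _).subset
  t_id f := by simp
  t' f g k := (f.isPullback g k).isoPullback.inv ≫
    chartMap 𝒜 (show g.carrier ∪ k.carrier ∪ f.carrier ⊆ f.carrier ∪ g.carrier ∪ k.carrier by
      intro a; simp only [Set.mem_union]; tauto) ≫ (g.isPullback k f).isoPullback.hom
  t_fac f g k := by
    rw [← cancel_epi (f.isPullback g k).isoPullback.hom]
    simp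
  cocycle f g k := by
    rw [← cancel_epi (f.isPullback g k).isoPullback.hom]
    simp
  f_open f g := inferInstance

/-- The scheme `Proj A` of the `M`-graded ring `A`. -/
def Proj : Scheme.{u} :=
  (glueData 𝒜).glued

/-- The open immersion `U_f ⟶ Proj A`. -/
def chartι (f : FiniteRelevantFamily 𝒜) : chart 𝒜 f.carrier ⟶ Proj 𝒜 :=
  (glueData 𝒜).ι f

end MultiProj

namespace MultiProj

variable {M R A : Type u} [AddCommGroup M] [DecidableEq M] [CommRing R] [CommRing A] [Algebra R A]
  (𝒜 : M → Submodule R A) [GradedAlgebra 𝒜]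

/-- The composition `R → A_0 → A_(f)`. -/
def toPotion (f : Set A) : R →+* Potion 𝒜 f :=
  (HomogeneousLocalization.fromZeroRingHom 𝒜 (Submonoid.closure f)).comp (algebraMap R (𝒜 0))

lemma potionMap_comp_toPotion {f g : Set A} (h : f ⊆ g) :
    (potionMap 𝒜 h).comp (toPotion 𝒜 f) = toPotion 𝒜 g := by
  ext r
  change (potionMap 𝒜 h (HomogeneousLocalization.mk _)).val = (HomogeneousLocalization.mk _).val
  simp only [HomogeneousLocalization.val_mk]
  rfl

/-- The morphism `U_f ⟶ Spec R`. -/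
def chartToSpec (f : Set A) : chart 𝒜 f ⟶ Spec (CommRingCat.of R) :=
  Spec.map (CommRingCat.ofHom (toPotion 𝒜 f))

@[simp]
lemma chartMap_chartToSpec {f g : Set A} (h : f ⊆ g) :
    chartMap 𝒜 h ≫ chartToSpec 𝒜 f = chartToSpec 𝒜 g := by
  rw [chartMap, chartToSpec, chartToSpec, ← Spec.map_comp, ← CommRingCat.ofHom_comp,
    potionMap_comp_toPotion]

/-- The structure morphism `Proj A ⟶ Spec R`, glued from the morphisms `U_f ⟶ Spec R`. -/
def Proj.toSpec : Proj 𝒜 ⟶ Spec (CommRingCat.of R) :=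
  Multicoequalizer.desc (glueData 𝒜).diagram _ (fun f ↦ chartToSpec 𝒜 f.carrier) (by
    rintro ⟨f, g⟩
    change chartMap 𝒜 _ ≫ chartToSpec 𝒜 _ = (chartMap 𝒜 _ ≫ chartMap 𝒜 _) ≫ chartToSpec 𝒜 _
    simp)

@[simp]
lemma chartι_toSpec (f : FiniteRelevantFamily 𝒜) :
    chartι 𝒜 f ≫ Proj.toSpec 𝒜 = chartToSpec 𝒜 f.carrier :=
  Multicoequalizer.π_desc _ _ _ _ _

variable (R' : Type u) [CommRing R'] [Algebra R R']

/-- The `M`-grading of the base change of `A` to `R'`: its component of degree `m` is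
`R' ⊗[R] 𝒜 m`. -/
abbrev baseChangeGrading : M → Submodule R' (R' ⊗[R] A) :=
  fun m ↦ (𝒜 m).baseChange R'

/-- The morphism of graded rings `a ↦ 1 ⊗ a`. -/
def toBaseChange : GradedRingHom 𝒜 (baseChangeGrading 𝒜 R') where
  toRingHom := (Algebra.TensorProduct.includeRight : A →ₐ[R] R' ⊗[R] A).toRingHom
  map_mem h := Submodule.tmul_mem_baseChange_of_mem _ h

variable {𝒜}

/-- If `g` is the image of `f` under `a ↦ 1 ⊗ a`, the morphism from the potion `A_(f)` to the
potion of `R' ⊗[R] A` relative to `g` induced by `a ↦ 1 ⊗ a`. -/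
def potionBaseChange {f : Set A} {g : Set (R' ⊗[R] A)} (h : (fun a ↦ 1 ⊗ₜ[R] a) '' f = g) :
    Potion 𝒜 f →+* Potion (baseChangeGrading 𝒜 R') g :=
  HomogeneousLocalization.map (toBaseChange 𝒜 R') <| Submonoid.closure_le.mpr fun _ ha ↦
    Submonoid.subset_closure (h ▸ Set.mem_image_of_mem _ ha)

end MultiProj

end

/-!
The proof compares two open covers indexed by the same families and consisting of the same affine
schemes.

Write `A'` for `R' ⊗[R] A`, and `1 ⊗ f` for the image in `A'` of a family `f` in `A`.

*Charts.* The potion of `A'` relative to `1 ⊗ f` is the base change of `A_(f)`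
(`isPushout_potionBaseChange`). Surjectivity of `R' ⊗[R] A_(f) → A'_(1 ⊗ f)` is clear from the
shape of the components of `A'`. For injectivity, write an element of the source as the image of
some `u ∈ R' ⊗[R] A_i` under division by a common denominator `q` of degree `i`; if its image is
zero, then `u` is killed by some `1 ⊗ s` with `s` a product of elements of `f`, and, as graded
components are direct summands of `A`, this already happens in `R' ⊗[R] A_(i + j)`.

It follows that `U_(1 ⊗ f)` is the preimage of `U_f` in `Proj A ×_{Spec R} Spec R'`
(`isPullback_chartToBaseChange`), so that these schemes cover the fibre product, with
intersections `U_(1 ⊗ (f ∪ f'))`. Families `f` for which some `1 ⊗ a` is zero give empty schemes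
and are discarded.

*Cover of `Proj A'`.* Not every relevant family of `A'` is of the form `1 ⊗ f`, but the charts
`U_(1 ⊗ f)` still cover `Proj A'` (`FiniteRelevantFamily.exists_baseChange_chartMap_eq`). Given a
point `p` of `U_g`, relevance of `g` is witnessed by finitely many homogeneous divisors `b`, because
the group of degrees is finitely generated. Such a `b`, of degree `m`, is invertible on `U_g` and is
an `R'`-linear combination of elements `1 ⊗ a` with `a ∈ A_m`, so one of these does not vanish at
`p`. The elements `a` chosen in this way form a relevant family `f` with `p ∈ U_(1 ⊗ f)`.

Both covers consist of the schemes `U_(1 ⊗ f)` and have the same pairwise intersections, so the two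
schemes are isomorphic (`Scheme.exists_iso_of_covers`), compatibly with the maps to `Spec R'` and
`Proj A`.
-/

noncomputable section

/-! ### Base change of potions -/

namespace MultiProj

section Pushout

variable {R R' P P' : Type u} [CommRing R] [CommRing R'] [CommRing P] [CommRing P']
  [Algebra R R'] [Algebra R P]

/-- The ring homomorphism `R' ⊗[R] P → P'` induced by `α : R' → P'` and `β : P → P'` that agree
on `R`; no `R`-algebra structure on `P'` has to be chosen. -/
def tensorDesc (α : R' →+* P') (β : P →+* P')
    (H : α.comp (algebraMap R R') = β.comp (algebraMap R P)) : R' ⊗[R] P →+* P' :=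
  letI := (α.comp (algebraMap R R')).toAlgebra
  (Algebra.TensorProduct.productMap (R := R) ⟨α, fun _ ↦ rfl⟩
    ⟨β, fun r ↦ (RingHom.congr_fun H r).symm⟩).toRingHom

@[simp]
lemma tensorDesc_tmul (α : R' →+* P') (β : P →+* P')
    (H : α.comp (algebraMap R R') = β.comp (algebraMap R P)) (r : R') (p : P) :
    tensorDesc α β H (r ⊗ₜ p) = α r * β p :=
  rfl

lemma isPushout_of_bijective_tensorDesc (α : R' →+* P') (β : P →+* P')
    (H : α.comp (algebraMap R R') = β.comp (algebraMap R P))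
    (hb : Function.Bijective (tensorDesc α β H)) :
    IsPushout (CommRingCat.ofHom (algebraMap R R')) (CommRingCat.ofHom (algebraMap R P))
      (CommRingCat.ofHom α) (CommRingCat.ofHom β) :=
  (CommRingCat.isPushout_tensorProduct R R' P).of_iso (Iso.refl _) (Iso.refl _) (Iso.refl _)
    (RingEquiv.ofBijective _ hb).toCommRingCatIso (by simp) (by simp)
    (by ext; simp) (by ext; simp)

end Pushout

variable {M R A : Type u} [AddCommGroup M] [DecidableEq M] [CommRing R] [CommRing A] [Algebra R A]
  {𝒜 : M → Submodule R A} [GradedAlgebra 𝒜]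

/-- The `R`-algebra structure on a potion given by `R → A_0 → A_(f)`, with scalar multiplication
defined through this ring homomorphism. -/
@[reducible]
def potionAlgebra (f : Set A) : Algebra R (Potion 𝒜 f) :=
  (toPotion 𝒜 f).toAlgebra

attribute [local instance] potionAlgebra

lemma val_toPotion (f : Set A) (r : R) :
    (toPotion 𝒜 f r).val = Localization.mk (algebraMap R A r) 1 :=
  rfl

/-- The map `A_i → A_(f)` sending `a` to `a / q`, for a denominator `q` of degree `i`. -/
def overDenominator {f : Set A} {i : M} {q : A} (hq : q ∈ 𝒜 i) (hqf : q ∈ Submonoid.closure f) :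
    𝒜 i →ₗ[R] Potion 𝒜 f where
  toFun a := HomogeneousLocalization.mk ⟨i, a, ⟨q, hq⟩, hqf⟩
  map_add' a b := by
    ext
    simp [Localization.add_mk_self]
  map_smul' r a := by
    rw [Algebra.smul_def]
    ext
    simp only [HomogeneousLocalization.val_mul, HomogeneousLocalization.val_mk]
    rw [RingHom.algebraMap_toAlgebra, RingHom.id_apply, val_toPotion, Localization.mk_mul]
    simp [Algebra.smul_def]

lemma val_overDenominator {f : Set A} {i : M} {q : A} (hq : q ∈ 𝒜 i)
    (hqf : q ∈ Submonoid.closure f) (a : 𝒜 i) :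
    (overDenominator hq hqf a).val = Localization.mk (a : A) ⟨q, hqf⟩ :=
  rfl

/-- Multiplication by a homogeneous element, as a map between graded components. -/
def mulGraded {i j : M} {s : A} (hs : s ∈ 𝒜 j) : 𝒜 i →ₗ[R] 𝒜 (i + j) where
  toFun a := ⟨a * s, SetLike.mul_mem_graded a.2 hs⟩
  map_add' _ _ := Subtype.ext (add_mul _ _ _)
  map_smul' _ _ := Subtype.ext (smul_mul_assoc _ _ _)

lemma overDenominator_mulGraded {f : Set A} {i j : M} {q s : A} (hq : q ∈ 𝒜 i)
    (hqf : q ∈ Submonoid.closure f) (hs : s ∈ 𝒜 j) (hsf : s ∈ Submonoid.closure f) :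
    overDenominator (SetLike.mul_mem_graded hq hs) (mul_mem hqf hsf) ∘ₗ mulGraded hs =
      overDenominator hq hqf := by
  ext a
  simp only [LinearMap.comp_apply, val_overDenominator]
  rw [Localization.mk_eq_mk_iff, Localization.r_iff_exists]
  refine ⟨1, ?_⟩
  simp [mulGraded]
  ring

variable (R' : Type u) [CommRing R'] [Algebra R R']

lemma toPotion_comp_algebraMap {f : Set A} {g : Set (R' ⊗[R] A)}
    (h : (fun a ↦ 1 ⊗ₜ[R] a) '' f = g) :
    (toPotion (baseChangeGrading 𝒜 R') g).comp (algebraMap R R') =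
      (potionBaseChange R' h).comp (algebraMap R (Potion 𝒜 f)) := by
  ext r
  change Localization.mk (algebraMap R R' r ⊗ₜ[R] (1 : A)) 1 =
    Localization.mk ((1 : R') ⊗ₜ[R] (algebraMap R A r)) _
  rw [Algebra.algebraMap_eq_smul_one, Algebra.algebraMap_eq_smul_one, TensorProduct.smul_tmul]
  congr 1

lemma closure_image_tmul {f : Set A} {g : Set (R' ⊗[R] A)}
    (h : (fun a ↦ 1 ⊗ₜ[R] a) '' f = g) {y : R' ⊗[R] A} :
    y ∈ Submonoid.closure g ↔ ∃ q ∈ Submonoid.closure f, 1 ⊗ₜ[R] q = y := by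
  have : Submonoid.closure g = (Submonoid.closure f).map
      (Algebra.TensorProduct.includeRight : A →ₐ[R] R' ⊗[R] A) := by
    rw [← h]
    exact (MonoidHom.map_mclosure
      (Algebra.TensorProduct.includeRight : A →ₐ[R] R' ⊗[R] A).toRingHom.toMonoidHom f).symm
  rw [this]
  rfl

/-- The map `R' ⊗[R] A_(f) → A'_(1 ⊗ f)`, where `A' = R' ⊗[R] A`, sends `u / q` to `u / (1 ⊗ q)`. -/
lemma val_tensorDesc_lTensor {f : Set A} {g : Set (R' ⊗[R] A)}
    (h : (fun a ↦ 1 ⊗ₜ[R] a) '' f = g) {i : M} {q : A} (hq : q ∈ 𝒜 i)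
    (hqf : q ∈ Submonoid.closure f) (u : R' ⊗[R] 𝒜 i) :
    (tensorDesc _ _ (toPotion_comp_algebraMap R' h)
      ((overDenominator hq hqf).lTensor R' u)).val =
      Localization.mk ((𝒜 i).subtype.lTensor R' u)
        ⟨1 ⊗ₜ[R] q, (closure_image_tmul R' h).mpr ⟨q, hqf, rfl⟩⟩ := by
  induction u using TensorProduct.induction_on with
  | zero => simp [Localization.mk_zero]
  | tmul r a =>
    simp only [LinearMap.lTensor_tmul, tensorDesc_tmul, HomogeneousLocalization.val_mul,
      val_toPotion]
    change _ * Localization.mk ((1 : R') ⊗ₜ[R] (a : A)) ⟨1 ⊗ₜ[R] q, _⟩ = _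
    rw [Localization.mk_mul]
    simp
  | add u v hu hv =>
    simp only [map_add, HomogeneousLocalization.val_add, hu, hv, Localization.add_mk_self]

/-- Elements of `R' ⊗[R] A_(f)` have a common denominator. -/
lemma exists_eq_lTensor_overDenominator {f : Set A} (t : R' ⊗[R] Potion 𝒜 f) :
    ∃ (i : M) (q : A) (hq : q ∈ 𝒜 i) (hqf : q ∈ Submonoid.closure f) (u : R' ⊗[R] 𝒜 i),
      (overDenominator hq hqf).lTensor R' u = t := by
  induction t using TensorProduct.induction_on with
  | zero => exact ⟨0, 1, SetLike.one_mem_graded 𝒜, one_mem _, 0, map_zero _⟩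
  | tmul r p =>
    obtain ⟨⟨i, a, ⟨q, hq⟩, hqf⟩, rfl⟩ := HomogeneousLocalization.mk_surjective p
    exact ⟨i, q, hq, hqf, r ⊗ₜ a, rfl⟩
  | add t t' ht ht' =>
    obtain ⟨i, q, hq, hqf, u, rfl⟩ := ht
    obtain ⟨j, s, hs, hsf, v, rfl⟩ := ht'
    -- `v / s = (v * q) / (s * q)`, up to transport along `j + i = i + j` and `s * q = q * s`.
    have key : ∃ w : R' ⊗[R] 𝒜 (i + j),
        (overDenominator (SetLike.mul_mem_graded hq hs) (mul_mem hqf hsf)).lTensor R' w =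
          (overDenominator hs hsf).lTensor R' v := by
      have e := overDenominator_mulGraded hs hsf hq hqf
      have aux : ∀ (k : M) (y : A) (hk : k = j + i) (hy : y = s * q) (h₁ : y ∈ 𝒜 k)
          (h₂ : y ∈ Submonoid.closure f), ∃ w : R' ⊗[R] 𝒜 k,
          (overDenominator h₁ h₂).lTensor R' w = (overDenominator hs hsf).lTensor R' v := by
        rintro _ _ rfl rfl h₁ h₂
        exact ⟨(mulGraded hq).lTensor R' v, by rw [← LinearMap.lTensor_comp_apply, e]⟩
      exact aux _ _ (add_comm _ _) (mul_comm _ _) _ _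
    obtain ⟨w, hw⟩ := key
    refine ⟨i + j, q * s, SetLike.mul_mem_graded hq hs, mul_mem hqf hsf,
      (mulGraded hs).lTensor R' u + w, ?_⟩
    rw [map_add, hw, ← LinearMap.lTensor_comp_apply, overDenominator_mulGraded hq hqf hs hsf]

/-- A graded component is a direct summand, so it remains a submodule after base change. -/
lemma lTensor_subtype_injective (i : M) :
    Function.Injective ((𝒜 i).subtype.lTensor R') := by
  have : (DirectSum.component R M (fun i ↦ 𝒜 i) i ∘ₗ
      (DirectSum.decomposeLinearEquiv 𝒜).toLinearMap) ∘ₗ (𝒜 i).subtype = LinearMap.id := by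
    ext a
    simp
  refine Function.LeftInverse.injective (g := (DirectSum.component R M (fun i ↦ 𝒜 i) i ∘ₗ
      (DirectSum.decomposeLinearEquiv 𝒜).toLinearMap).lTensor R') fun u ↦ ?_
  rw [← LinearMap.lTensor_comp_apply, this, LinearMap.lTensor_id, LinearMap.id_apply]

lemma bijective_tensorDesc_potionBaseChange {f : Set A} {g : Set (R' ⊗[R] A)}
    (hf : ∀ a ∈ f, SetLike.IsHomogeneousElem 𝒜 a) (h : (fun a ↦ 1 ⊗ₜ[R] a) '' f = g) :
    Function.Bijective
      (tensorDesc _ _ (toPotion_comp_algebraMap (𝒜 := 𝒜) R' h)) := by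
  constructor
  · rw [injective_iff_map_eq_zero]
    intro t ht
    obtain ⟨i, q, hq, hqf, u, rfl⟩ := exists_eq_lTensor_overDenominator R' t
    replace ht := congr_arg HomogeneousLocalization.val ht
    rw [val_tensorDesc_lTensor, HomogeneousLocalization.val_zero, Localization.mk_eq_mk',
      IsLocalization.mk'_eq_zero_iff] at ht
    obtain ⟨⟨y, hy⟩, hyu⟩ := ht
    obtain ⟨s, hsf, rfl⟩ := (closure_image_tmul R' h).mp hy
    obtain ⟨j, hs⟩ := isHomogeneousElem_of_mem_closure hf hsf
    have hmul : ∀ u : R' ⊗[R] 𝒜 i, (1 ⊗ₜ[R] s) * (𝒜 i).subtype.lTensor R' u =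
        (𝒜 (i + j)).subtype.lTensor R' ((mulGraded hs).lTensor R' u) := by
      intro u
      induction u using TensorProduct.induction_on with
      | zero => simp
      | tmul r a => simp [mulGraded, mul_comm]
      | add u v hu hv => simp only [map_add, mul_add, hu, hv]
    have h0 : (mulGraded hs).lTensor R' u = 0 :=
      lTensor_subtype_injective R' (i + j) (by rw [← hmul, map_zero]; exact hyu)
    rw [← overDenominator_mulGraded hq hqf hs hsf, LinearMap.lTensor_comp_apply, h0, map_zero]
  · intro x
    obtain ⟨⟨i, ⟨_, ha⟩, ⟨y, hy⟩, hyg⟩, rfl⟩ := HomogeneousLocalization.mk_surjective x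
    obtain ⟨q, hqf, rfl⟩ := (closure_image_tmul R' h).mp hyg
    by_cases h0 : 1 ⊗ₜ[R] q = (0 : R' ⊗[R] A)
    -- If `1 ⊗ q = 0`, its degree does not determine that of `q`, but the target is the zero ring.
    · have := HomogeneousLocalization.subsingleton (baseChangeGrading 𝒜 R')
        (x := Submonoid.closure g) (by simpa [h0] using hyg)
      exact ⟨0, Subsingleton.elim _ _⟩
    · obtain ⟨j, hq⟩ := isHomogeneousElem_of_mem_closure hf hqf
      obtain rfl : i = j := DirectSum.degree_eq_of_mem_mem (baseChangeGrading 𝒜 R') hy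
        (Submodule.tmul_mem_baseChange_of_mem _ hq) h0
      obtain ⟨u, rfl⟩ := ha
      refine ⟨(overDenominator hq hqf).lTensor R' u, ?_⟩
      ext
      rw [val_tensorDesc_lTensor]
      rfl

/-- The square of rings behind the base change of a chart. -/
lemma isPushout_potionBaseChange {f : Set A} {g : Set (R' ⊗[R] A)}
    (hf : ∀ a ∈ f, SetLike.IsHomogeneousElem 𝒜 a) (h : (fun a ↦ 1 ⊗ₜ[R] a) '' f = g) :
    IsPushout (CommRingCat.ofHom (algebraMap R R')) (CommRingCat.ofHom (toPotion 𝒜 f))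
      (CommRingCat.ofHom (toPotion (baseChangeGrading 𝒜 R') g))
      (CommRingCat.ofHom (potionBaseChange R' h)) :=
  isPushout_of_bijective_tensorDesc _ _ _ (bijective_tensorDesc_potionBaseChange R' hf h)

end MultiProj

/-! ### Covering the projective spectrum of the base change -/

namespace MultiProj

section Graded

variable {M A σ : Type u} [AddCommGroup M] [DecidableEq M] [CommRing A] [SetLike σ A]
  [AddSubgroupClass σ A] {𝒜 : M → σ} [GradedRing 𝒜]

omit [DecidableEq M] [AddSubgroupClass σ A] [GradedRing 𝒜] in
/-- To be relevant, a family need not use divisors: the degrees of its own elements may suffice. -/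
lemma isRelevant_of_le_degreeGroup {f : Set A} {N : AddSubgroup M}
    (hN : ∀ x : M, ∃ n : ℕ, 0 < n ∧ n • x ∈ N) (h : N ≤ degreeGroup 𝒜 f) :
    IsRelevant 𝒜 f := by
  intro x
  obtain ⟨n, hn, hx⟩ := hN x
  refine ⟨n, hn, AddSubgroup.closure_mono ?_ (h hx)⟩
  rintro m ⟨a, ha, h0, ham⟩
  exact ⟨a, ⟨h0, ⟨m, ham⟩, a, ha, dvd_rfl⟩, h0, ham⟩

omit [DecidableEq M] [AddSubgroupClass σ A] [GradedRing 𝒜] in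
/-- Applied to the homogeneous divisors of a family, this says that relevance is witnessed by
finitely many of them. -/
lemma exists_finite_degreeGroup_eq [AddGroup.FG M] (D : Set A) :
    ∃ S ⊆ D, S.Finite ∧ degreeGroup 𝒜 S = degreeGroup 𝒜 D := by
  have : Module.Finite ℤ M := Module.Finite.iff_addGroup_fg.mpr inferInstance
  obtain ⟨t, ht, hspan⟩ := (Submodule.fg_span_iff_fg_span_finset_subset (R := ℤ)
    {m | ∃ a ∈ D, a ≠ 0 ∧ a ∈ 𝒜 m}).mp (IsNoetherian.noetherian _)
  choose! a haD ha0 ham using fun m (hm : m ∈ t) ↦ ht hm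
  refine ⟨a '' t, by rintro _ ⟨m, hm, rfl⟩; exact haD m hm, t.finite_toSet.image a,
    le_antisymm ?_ ?_⟩
  · refine AddSubgroup.closure_mono ?_
    rintro m ⟨_, ⟨k, hk, rfl⟩, h0, hm⟩
    exact ⟨a k, haD k hk, h0, hm⟩
  · rw [degreeGroup, ← Submodule.span_int_eq_addSubgroupClosure, hspan,
      Submodule.span_int_eq_addSubgroupClosure]
    exact AddSubgroup.closure_mono fun m hm ↦ ⟨a m, ⟨m, hm, rfl⟩, ha0 m hm, ham m hm⟩

/-- If each element of a finite set `T` divides the numerator of a degree zero fraction not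
vanishing at `p`, then a single such fraction works for all of `T`: the product. -/
lemma exists_fraction_notMem {g T : Set A} (hT : T.Finite) (p : Ideal (Potion 𝒜 g)) [p.IsPrime]
    (H : ∀ e ∈ T, ∃ (d : M) (x z : A) (hx : x ∈ 𝒜 d) (hz : z ∈ 𝒜 d)
      (hzg : z ∈ Submonoid.closure g), (∃ y ∈ Submonoid.closure (g ∪ T), x ∣ y) ∧ e ∣ x ∧
        HomogeneousLocalization.mk ⟨d, ⟨x, hx⟩, ⟨z, hz⟩, hzg⟩ ∉ p) :
    ∃ (d : M) (x z : A) (hx : x ∈ 𝒜 d) (hz : z ∈ 𝒜 d)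
      (hzg : z ∈ Submonoid.closure g), (∃ y ∈ Submonoid.closure (g ∪ T), x ∣ y) ∧
        (∀ e ∈ T, e ∣ x) ∧ HomogeneousLocalization.mk ⟨d, ⟨x, hx⟩, ⟨z, hz⟩, hzg⟩ ∉ p := by
  refine Set.Finite.induction_on_subset (motive := fun T' _ ↦ ∃ (d : M) (x z : A) (hx : x ∈ 𝒜 d)
      (hz : z ∈ 𝒜 d) (hzg : z ∈ Submonoid.closure g), (∃ y ∈ Submonoid.closure (g ∪ T), x ∣ y) ∧
        (∀ e ∈ T', e ∣ x) ∧ HomogeneousLocalization.mk ⟨d, ⟨x, hx⟩, ⟨z, hz⟩, hzg⟩ ∉ p) T hT ?_ ?_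
  · refine ⟨0, 1, 1, SetLike.one_mem_graded 𝒜, SetLike.one_mem_graded 𝒜, one_mem _,
      ⟨1, one_mem _, dvd_rfl⟩, by simp, ?_⟩
    exact (Ideal.ne_top_iff_one p).mp ‹p.IsPrime›.ne_top
  · intro e _ heT _ _ ih
    obtain ⟨d, x, z, hx, hz, hzg, ⟨y, hy, hxy⟩, hex, hp⟩ := H _ heT
    obtain ⟨d', x', z', hx', hz', hzg', ⟨y', hy', hxy'⟩, hex', hp'⟩ := ih
    refine ⟨d + d', x * x', z * z', SetLike.mul_mem_graded hx hx', SetLike.mul_mem_graded hz hz',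
      mul_mem hzg hzg', ⟨y * y', mul_mem hy hy', mul_dvd_mul hxy hxy'⟩, ?_, ?_⟩
    · rintro e (rfl | he)
      · exact hex.mul_right _
      · exact (hex' e he).mul_left _
    · exact fun h ↦ (‹p.IsPrime›.mem_or_mem h).elim hp hp'

/-- A point of `U_g` at which a suitable degree zero fraction does not vanish lies in the open
subscheme `U_(g ∪ T)`. -/
lemma exists_chartMap_eq {g T : Set A} (hg : ∀ a ∈ g, SetLike.IsHomogeneousElem 𝒜 a)
    (hT : ∀ a ∈ T, SetLike.IsHomogeneousElem 𝒜 a) (p : chart 𝒜 g) {d : M} {x z : A}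
    (hx : x ∈ 𝒜 d) (hz : z ∈ 𝒜 d) (hzg : z ∈ Submonoid.closure g)
    (hxy : ∃ y ∈ Submonoid.closure (g ∪ T), x ∣ y) (hTx : ∀ e ∈ T, e ∣ x)
    (hp : HomogeneousLocalization.mk ⟨d, ⟨x, hx⟩, ⟨z, hz⟩, hzg⟩ ∉ p.asIdeal) :
    ∃ y, chartMap 𝒜 (Set.subset_union_left : g ⊆ g ∪ T) y = p := by
  let := (potionMap 𝒜 (Set.subset_union_left : g ⊆ g ∪ T)).toAlgebra
  have := isLocalization_potionMap hg hT hx hz hzg hxy hTx rfl Set.subset_union_left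
  have hr := PrimeSpectrum.localization_away_comap_range (Potion 𝒜 (g ∪ T))
    (HomogeneousLocalization.mk ⟨d, ⟨x, hx⟩, ⟨z, hz⟩, hzg⟩ : Potion 𝒜 g)
  have hmem : p ∈ Set.range (PrimeSpectrum.comap
      (algebraMap (Potion 𝒜 g) (Potion 𝒜 (g ∪ T)))) := by
    rw [hr]
    exact hp
  exact hmem

end Graded

variable {M R A : Type u} [AddCommGroup M] [DecidableEq M] [CommRing R] [CommRing A] [Algebra R A]
  {𝒜 : M → Submodule R A} [GradedAlgebra 𝒜] (R' : Type u) [CommRing R'] [Algebra R R']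

attribute [local instance] potionAlgebra

/-- If `b` of degree `m` becomes invertible on `U_g`, then at each point of `U_g` some `1 ⊗ a`
with `a ∈ A_m` does not vanish, because `b` is an `R'`-linear combination of such elements. -/
lemma exists_tmul_fraction_notMem {g : Set (R' ⊗[R] A)} {m k : M} {b c : R' ⊗[R] A}
    (hb : b ∈ baseChangeGrading 𝒜 R' m) (hc : c ∈ baseChangeGrading 𝒜 R' k)
    (hbc : b * c ∈ Submonoid.closure g) (p : Ideal (Potion (baseChangeGrading 𝒜 R') g))
    (hp : p ≠ ⊤) :
    ∃ (a : A) (ha : a ∈ 𝒜 m), HomogeneousLocalization.mk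
      ⟨m + k, ⟨(1 ⊗ₜ[R] a) * c, SetLike.mul_mem_graded
        (Submodule.tmul_mem_baseChange_of_mem (1 : R') ha) hc⟩,
        ⟨b * c, SetLike.mul_mem_graded hb hc⟩, hbc⟩ ∉ p := by
  by_contra! H
  let φ : R' ⊗[R] 𝒜 m →ₗ[R'] Potion (baseChangeGrading 𝒜 R') g :=
    (overDenominator (SetLike.mul_mem_graded hb hc) hbc ∘ₗ mulGraded hc) ∘ₗ
      (show R' ⊗[R] 𝒜 m →ₗ[R'] baseChangeGrading 𝒜 R' m from
        ((𝒜 m).subtype.baseChange R').rangeRestrict)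
  have hφ : ∀ u, φ u ∈ p := by
    intro u
    induction u using TensorProduct.induction_on with
    | zero => rw [map_zero]; exact p.zero_mem
    | tmul r a =>
      have : r ⊗ₜ[R] a = r • (1 : R') ⊗ₜ[R] a := by
        rw [TensorProduct.smul_tmul', smul_eq_mul, mul_one]
      rw [this, show φ (r • (1 : R') ⊗ₜ[R] a) = toPotion _ g r * φ ((1 : R') ⊗ₜ[R] a) from
        φ.map_smul r _]
      exact p.mul_mem_left _ (H a a.2)
    | add u v hu hv =>
      rw [map_add]
      exact add_mem hu hv
  obtain ⟨u, hu⟩ := hb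
  refine hp ((Ideal.eq_top_iff_one p).mpr ?_)
  convert! hφ u using 1
  subst hu
  ext
  rw [HomogeneousLocalization.val_one]
  exact (Localization.mk_self (⟨_, hbc⟩ : Submonoid.closure g)).symm

omit [DecidableEq M] [GradedAlgebra 𝒜] in
lemma isRelevant_image_tmul {f : Set A} (hf : IsRelevant 𝒜 f)
    (h0 : ∀ a ∈ f, (1 : R') ⊗ₜ[R] a ≠ 0) :
    IsRelevant (baseChangeGrading 𝒜 R') ((fun a ↦ (1 : R') ⊗ₜ[R] a) '' f) := by
  intro x
  obtain ⟨n, hn, hx⟩ := hf x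
  refine ⟨n, hn, AddSubgroup.closure_mono ?_ hx⟩
  rintro m ⟨b, ⟨-, -, a, ha, c, rfl⟩, -, hbm⟩
  have hmul : (1 : R') ⊗ₜ[R] (b * c) = (1 ⊗ₜ[R] b) * (1 ⊗ₜ[R] c) := by simp
  have hb0 : (1 : R') ⊗ₜ[R] b ≠ 0 := fun h ↦ h0 _ ha (by rw [hmul, h, zero_mul])
  have hbm' : (1 : R') ⊗ₜ[R] b ∈ baseChangeGrading 𝒜 R' m :=
    Submodule.tmul_mem_baseChange_of_mem _ hbm
  exact ⟨1 ⊗ₜ b, ⟨hb0, ⟨m, hbm'⟩, 1 ⊗ₜ (b * c), ⟨_, ha, rfl⟩, 1 ⊗ₜ c, hmul⟩, hb0, hbm'⟩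

namespace FiniteRelevantFamily

/-- The image of a finite relevant family under `a ↦ 1 ⊗ a`, provided that it does not
contain `0`. -/
@[simps]
def baseChange (f : FiniteRelevantFamily 𝒜) (h0 : ∀ a ∈ f.carrier, (1 : R') ⊗ₜ[R] a ≠ 0) :
    FiniteRelevantFamily (baseChangeGrading 𝒜 R') where
  carrier := (fun a ↦ (1 : R') ⊗ₜ[R] a) '' f.carrier
  finite := f.finite.image _
  ne_zero := by
    rintro _ ⟨a, ha, rfl⟩
    exact h0 a ha
  homogeneous := by
    rintro _ ⟨a, ha, rfl⟩
    obtain ⟨m, hm⟩ := f.homogeneous a ha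
    exact ⟨m, Submodule.tmul_mem_baseChange_of_mem _ hm⟩
  relevant := isRelevant_image_tmul R' f.relevant h0

/-- Each point `p` of a chart `U_g` of `Proj (R' ⊗[R] A)` lies in `U_(1 ⊗ f)` for some `f`. The
family `f` consists of elements `a b` of `A`, of the same degrees as finitely many homogeneous
divisors `b` of `g` witnessing the relevance of `g`, such that `1 ⊗ a b` does not vanish at `p`. -/
lemma exists_baseChange_chartMap_eq [AddGroup.FG M]
    (g : FiniteRelevantFamily (baseChangeGrading 𝒜 R'))
    (p : chart (baseChangeGrading 𝒜 R') g.carrier) :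
    ∃ (f : FiniteRelevantFamily 𝒜) (h0 : ∀ a ∈ f.carrier, (1 : R') ⊗ₜ[R] a ≠ 0)
      (y : chart (baseChangeGrading 𝒜 R') (g.carrier ∪ (f.baseChange R' h0).carrier)),
      chartMap (baseChangeGrading 𝒜 R') Set.subset_union_left y = p := by
  obtain ⟨S, hSg, hSfin, hS⟩ := exists_finite_degreeGroup_eq (𝒜 := baseChangeGrading 𝒜 R')
    (homogeneousDivisors (baseChangeGrading 𝒜 R') g.carrier)
  have key : ∀ b ∈ S, ∃ (m k : M) (c : R' ⊗[R] A) (a : A) (hb : b ∈ baseChangeGrading 𝒜 R' m)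
      (hc : c ∈ baseChangeGrading 𝒜 R' k) (hbc : b * c ∈ Submonoid.closure g.carrier)
      (ha : a ∈ 𝒜 m), HomogeneousLocalization.mk
      ⟨m + k, ⟨(1 ⊗ₜ[R] a) * c, SetLike.mul_mem_graded
        (Submodule.tmul_mem_baseChange_of_mem (1 : R') ha) hc⟩,
        ⟨b * c, SetLike.mul_mem_graded hb hc⟩, hbc⟩ ∉ p.asIdeal := by
    intro b hbS
    obtain ⟨-, ⟨m, hb⟩, y, hy, hby⟩ := hSg hbS
    obtain ⟨j, hj⟩ := g.homogeneous y hy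
    obtain ⟨c, hc, rfl⟩ := exists_homogeneous_cofactor hb hj hby
    obtain ⟨a, ha, hap⟩ := exists_tmul_fraction_notMem R' hb hc (Submonoid.subset_closure hy)
      p.asIdeal p.isPrime.ne_top
    exact ⟨m, _, c, a, hb, hc, _, ha, hap⟩
  choose! m k c a hb hc hbc ha hap using key
  -- If `1 ⊗ a b` were zero, so would be the corresponding fraction, which does not lie in `p`.
  have ha0 : ∀ b ∈ S, (1 : R') ⊗ₜ[R] a b ≠ 0 := by
    intro b hbS h0
    refine hap b hbS ?_
    convert! p.asIdeal.zero_mem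
    exact HomogeneousLocalization.mk_eq_zero_of_num _ (by simp [h0])
  let f : FiniteRelevantFamily 𝒜 :=
    { carrier := a '' S
      finite := hSfin.image a
      ne_zero := by
        rintro _ ⟨b, hbS, rfl⟩ h0
        exact ha0 b hbS (by rw [h0, TensorProduct.tmul_zero])
      homogeneous := by
        rintro _ ⟨b, hbS, rfl⟩
        exact ⟨m b, ha b hbS⟩
      relevant := by
        refine isRelevant_of_le_degreeGroup (N := degreeGroup (baseChangeGrading 𝒜 R') S)
          (by rw [hS]; exact g.relevant) (AddSubgroup.closure_mono ?_)
        rintro l ⟨b, hbS, hb0, hbl⟩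
        obtain rfl := DirectSum.degree_eq_of_mem_mem _ hbl (hb b hbS) hb0
        refine ⟨a b, ⟨b, hbS, rfl⟩, fun h0 ↦ ha0 b hbS ?_, ha b hbS⟩
        rw [h0, TensorProduct.tmul_zero] }
  have hf0 : ∀ a ∈ f.carrier, (1 : R') ⊗ₜ[R] a ≠ 0 := by
    rintro _ ⟨b, hbS, rfl⟩
    exact ha0 b hbS
  have := p.isPrime
  obtain ⟨d, x, z, hx, hz, hzg, hxy, hTx, hxp⟩ :=
    exists_fraction_notMem (f.baseChange R' hf0).finite p.asIdeal (by
      rintro _ ⟨_, ⟨b, hbS, rfl⟩, rfl⟩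
      refine ⟨_, _, _, _, _, _, ?_, ?_, hap b hbS⟩
      · refine ⟨1 ⊗ₜ a b * (b * c b), mul_mem (Submonoid.subset_closure (Or.inr ?_))
          (Submonoid.closure_mono Set.subset_union_left (hbc b hbS)),
          mul_dvd_mul_left _ (dvd_mul_left _ _)⟩
        exact ⟨_, ⟨b, hbS, rfl⟩, rfl⟩
      · exact dvd_mul_right _ _)
  exact ⟨f, hf0, exists_chartMap_eq g.homogeneous (f.baseChange R' hf0).homogeneous p hx hz hzg
    hxy hTx hxp⟩

end FiniteRelevantFamily

end MultiProj

/-! ### Comparison of the two covers -/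

/-- Two schemes with open covers by the same schemes and with the same pairwise intersections are
isomorphic. -/
lemma AlgebraicGeometry.Scheme.exists_iso_of_covers {ι : Type u} {X : ι → Scheme.{u}}
    {Y Z : Scheme.{u}} (j : ∀ i, X i ⟶ Y) (k : ∀ i, X i ⟶ Z)
    [∀ i, IsOpenImmersion (j i)] [∀ i, IsOpenImmersion (k i)]
    (hj : ∀ y, ∃ i x, j i x = y) (hk : ∀ z, ∃ i x, k i x = z) {W : ι → ι → Scheme.{u}}
    (p : ∀ i i', W i i' ⟶ X i) (q : ∀ i i', W i i' ⟶ X i')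
    (hpj : ∀ i i', IsPullback (p i i') (q i i') (j i) (j i'))
    (hpk : ∀ i i', IsPullback (p i i') (q i i') (k i) (k i')) :
    ∃ e : Y ≅ Z, ∀ i, j i ≫ e.hom = k i := by
  let 𝒰 : Y.OpenCover := Scheme.Cover.mkOfCovers ι X j hj
  let 𝒱 : Z.OpenCover := Scheme.Cover.mkOfCovers ι X k hk
  have h𝒰 (i i' : ι) : pullback.fst (j i) (j i') ≫ k i = pullback.snd (j i) (j i') ≫ k i' := by
    rw [← cancel_epi (hpj i i').isoPullback.hom]
    simpa using (hpk i i').w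
  have h𝒱 (i i' : ι) : pullback.fst (k i) (k i') ≫ j i = pullback.snd (k i) (k i') ≫ j i' := by
    rw [← cancel_epi (hpk i i').isoPullback.hom]
    simpa using (hpj i i').w
  have e₁ (i : ι) : j i ≫ 𝒰.glueMorphisms k h𝒰 = k i := 𝒰.ι_glueMorphisms k h𝒰 i
  have e₂ (i : ι) : k i ≫ 𝒱.glueMorphisms j h𝒱 = j i := 𝒱.ι_glueMorphisms j h𝒱 i
  refine ⟨⟨𝒰.glueMorphisms k h𝒰, 𝒱.glueMorphisms j h𝒱, ?_, ?_⟩, e₁⟩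
  · refine Scheme.Cover.hom_ext 𝒰 _ _ fun (i : ι) ↦ ?_
    change j i ≫ _ ≫ _ = j i ≫ _
    rw [reassoc_of% e₁ i, e₂, Category.comp_id]
  · refine Scheme.Cover.hom_ext 𝒱 _ _ fun (i : ι) ↦ ?_
    change k i ≫ _ ≫ _ = k i ≫ _
    rw [reassoc_of% e₂ i, e₁, Category.comp_id]

namespace MultiProj

section Charts

variable {M A σ : Type u} [AddCommGroup M] [DecidableEq M] [CommRing A] [SetLike σ A]
  [AddSubgroupClass σ A] {𝒜 : M → σ} [GradedRing 𝒜]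

instance isOpenImmersion_chartι (f : FiniteRelevantFamily 𝒜) : IsOpenImmersion (chartι 𝒜 f) :=
  (glueData 𝒜).ι_isOpenImmersion f

lemma exists_chartι_eq (x : Proj 𝒜) : ∃ f y, chartι 𝒜 f y = x :=
  (glueData 𝒜).ι_jointly_surjective x

/-- In `Proj A`, the intersection of `U_f` and `U_g` is `U_(f ∪ g)`. -/
lemma isPullback_chartι (f g : FiniteRelevantFamily 𝒜) :
    IsPullback (chartMap 𝒜 (Set.subset_union_left : f.carrier ⊆ f.carrier ∪ g.carrier))
      (chartMap 𝒜 (Set.subset_union_right : g.carrier ⊆ f.carrier ∪ g.carrier))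
      (chartι 𝒜 f) (chartι 𝒜 g) := by
  have h : (glueData 𝒜).t f g ≫ (glueData 𝒜).f g f =
      chartMap 𝒜 (Set.subset_union_right : g.carrier ⊆ f.carrier ∪ g.carrier) :=
    chartMap_comp 𝒜 _ _
  have := IsPullback.of_isLimit ((glueData 𝒜).vPullbackConeIsLimit f g)
  change IsPullback _ ((glueData 𝒜).t f g ≫ (glueData 𝒜).f g f) _ _ at this
  rw [h] at this
  exact this

end Charts

variable {M R A : Type u} [AddCommGroup M] [DecidableEq M] [CommRing R] [CommRing A] [Algebra R A]
  (𝒜 : M → Submodule R A) [GradedAlgebra 𝒜] (R' : Type u) [CommRing R'] [Algebra R R']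

/-- The base change `Proj A ×_{Spec R} Spec R'`. -/
abbrev projBaseChange : Scheme.{u} :=
  pullback (Proj.toSpec 𝒜) (Spec.map (CommRingCat.ofHom (algebraMap R R')))

variable {𝒜}

/-- The morphism `U_(1 ⊗ f) ⟶ U_f`. As for `potionBaseChange`, the set `1 ⊗ f` is passed as a set `g`
with a proof that it is the image of `f`, so that `g` can be the carrier of a relevant family. -/
def chartBaseChange {f : Set A} {g : Set (R' ⊗[R] A)} (h : (fun a ↦ 1 ⊗ₜ[R] a) '' f = g) :
    chart (baseChangeGrading 𝒜 R') g ⟶ chart 𝒜 f :=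
  Spec.map (CommRingCat.ofHom (potionBaseChange R' h))

lemma chartMap_chartBaseChange {f f' : Set A} {g g' : Set (R' ⊗[R] A)}
    (h : (fun a ↦ 1 ⊗ₜ[R] a) '' f = g) (h' : (fun a ↦ 1 ⊗ₜ[R] a) '' f' = g') (hf : f ⊆ f')
    (hg : g ⊆ g') :
    chartMap (baseChangeGrading 𝒜 R') hg ≫ chartBaseChange R' h =
      chartBaseChange R' h' ≫ chartMap 𝒜 hf := by
  rw [chartMap, chartBaseChange, chartMap, chartBaseChange, ← Spec.map_comp, ← Spec.map_comp,
    ← CommRingCat.ofHom_comp, ← CommRingCat.ofHom_comp]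
  congr 2
  ext x
  obtain ⟨c, rfl⟩ := x.mk_surjective
  rfl

/-- `U_(1 ⊗ f)` is the base change of `U_f`. -/
lemma isPullback_chartBaseChange {f : Set A} {g : Set (R' ⊗[R] A)}
    (hf : ∀ a ∈ f, SetLike.IsHomogeneousElem 𝒜 a) (h : (fun a ↦ 1 ⊗ₜ[R] a) '' f = g) :
    IsPullback (chartToSpec (baseChangeGrading 𝒜 R') g) (chartBaseChange R' h)
      (Spec.map (CommRingCat.ofHom (algebraMap R R'))) (chartToSpec 𝒜 f) :=
  isPullback_SpecMap_of_isPushout _ _ _ _ (isPushout_potionBaseChange R' hf h)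

/-- The morphism `U_(1 ⊗ f) ⟶ Proj A ×_{Spec R} Spec R'`. -/
def chartToBaseChange (f : FiniteRelevantFamily 𝒜) {g : Set (R' ⊗[R] A)}
    (h : (fun a ↦ 1 ⊗ₜ[R] a) '' f.carrier = g) :
    chart (baseChangeGrading 𝒜 R') g ⟶ projBaseChange 𝒜 R' :=
  pullback.lift (chartBaseChange R' h ≫ chartι 𝒜 f) (chartToSpec (baseChangeGrading 𝒜 R') g) (by
    rw [Category.assoc, chartι_toSpec, (isPullback_chartBaseChange R' f.homogeneous h).w])

section

variable (f : FiniteRelevantFamily 𝒜) {g : Set (R' ⊗[R] A)}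
  (h : (fun a ↦ 1 ⊗ₜ[R] a) '' f.carrier = g)

@[simp]
lemma chartToBaseChange_fst :
    chartToBaseChange R' f h ≫ pullback.fst _ _ = chartBaseChange R' h ≫ chartι 𝒜 f :=
  pullback.lift_fst _ _ _

@[simp]
lemma chartToBaseChange_snd :
    chartToBaseChange R' f h ≫ pullback.snd _ _ = chartToSpec (baseChangeGrading 𝒜 R') g :=
  pullback.lift_snd _ _ _

/-- `U_(1 ⊗ f)` is the preimage of `U_f` in `Proj A ×_{Spec R} Spec R'`. -/
lemma isPullback_chartToBaseChange :
    IsPullback (chartToBaseChange R' f h) (chartBaseChange R' h)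
      (pullback.fst (Proj.toSpec 𝒜) (Spec.map (CommRingCat.ofHom (algebraMap R R'))))
      (chartι 𝒜 f) := by
  refine IsPullback.of_right ?_ (chartToBaseChange_fst R' f h) (IsPullback.of_hasPullback _ _).flip
  rw [chartToBaseChange_snd, chartι_toSpec]
  exact isPullback_chartBaseChange R' f.homogeneous h

instance isOpenImmersion_chartToBaseChange : IsOpenImmersion (chartToBaseChange R' f h) :=
  MorphismProperty.of_isPullback (P := @IsOpenImmersion)
    (isPullback_chartToBaseChange R' f h).flip inferInstance

/-- In `Proj A ×_{Spec R} Spec R'`, the intersection of `U_(1 ⊗ f)` and `U_(1 ⊗ f')` is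
`U_(1 ⊗ (f ∪ f'))`. -/
lemma isPullback_chartMap_chartToBaseChange (f' : FiniteRelevantFamily 𝒜) {g' : Set (R' ⊗[R] A)}
    (h' : (fun a ↦ 1 ⊗ₜ[R] a) '' f'.carrier = g') :
    IsPullback (chartMap (baseChangeGrading 𝒜 R') (Set.subset_union_left : g ⊆ g ∪ g'))
      (chartMap (baseChangeGrading 𝒜 R') (Set.subset_union_right : g' ⊆ g ∪ g'))
      (chartToBaseChange R' f h) (chartToBaseChange R' f' h') := by
  have hu : (fun a ↦ (1 : R') ⊗ₜ[R] a) '' (f.carrier ∪ f'.carrier) = g ∪ g' := by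
    rw [Set.image_union, h, h']
  have hhom : ∀ a ∈ f.carrier ∪ f'.carrier, SetLike.IsHomogeneousElem 𝒜 a := by
    rintro a (ha | ha)
    exacts [f.homogeneous a ha, f'.homogeneous a ha]
  have hl := chartMap_chartBaseChange (𝒜 := 𝒜) R' h hu Set.subset_union_left Set.subset_union_left
  have hr := chartMap_chartBaseChange (𝒜 := 𝒜) R' h' hu Set.subset_union_right
    Set.subset_union_right
  -- Both `U_(1 ⊗ f)` and `U_(1 ⊗ (f ∪ f'))` are base changes along `Spec R' ⟶ Spec R`.
  have sq : IsPullback (chartMap (baseChangeGrading 𝒜 R') (Set.subset_union_left : g ⊆ g ∪ g'))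
      (chartBaseChange R' hu) (chartBaseChange R' h)
      (chartMap 𝒜 (Set.subset_union_left : f.carrier ⊆ f.carrier ∪ f'.carrier)) := by
    refine IsPullback.of_right ?_ hl (isPullback_chartBaseChange R' f.homogeneous h)
    rw [chartMap_chartToSpec, chartMap_chartToSpec]
    exact isPullback_chartBaseChange R' hhom hu
  have outer := sq.flip.paste_horiz (isPullback_chartι f f').flip
  rw [← hr, ← chartToBaseChange_fst R' f h] at outer
  -- The square over `U_f'` is the pasting of the wanted square with the pullback square
  -- exhibiting `U_(1 ⊗ f')` as the preimage of `U_f'`.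
  refine (IsPullback.of_right outer ?_ (isPullback_chartToBaseChange R' f' h').flip).flip
  refine pullback.hom_ext ?_ ?_
  · rw [Category.assoc, Category.assoc, chartToBaseChange_fst, chartToBaseChange_fst,
      reassoc_of% hl, reassoc_of% hr, (isPullback_chartι f f').w]
  · simp

end

/-- The preimages of the `U_f` cover `Proj A ×_{Spec R} Spec R'`. Families for which some `1 ⊗ a`
vanishes can be left out, since the corresponding preimage is then the spectrum of the zero
ring. -/
lemma exists_chartToBaseChange_eq (z : projBaseChange 𝒜 R') :
    ∃ (f : FiniteRelevantFamily 𝒜) (h0 : ∀ a ∈ f.carrier, (1 : R') ⊗ₜ[R] a ≠ 0)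
      (x : chart (baseChangeGrading 𝒜 R') (f.baseChange R' h0).carrier),
      chartToBaseChange R' f rfl x = z := by
  obtain ⟨f, y, hy⟩ := exists_chartι_eq (pullback.fst (Proj.toSpec 𝒜) _ z)
  have sq := isPullback_chartToBaseChange R' f rfl
  obtain ⟨t, ht, -⟩ := Scheme.Pullback.exists_preimage_pullback z y hy.symm
  have hx : chartToBaseChange R' f rfl (sq.isoPullback.inv t) = z := by
    rw [← Scheme.Hom.comp_apply, sq.isoPullback_inv_fst, ht]
  refine ⟨f, fun a ha h0 ↦ ?_, _, hx⟩
  have := HomogeneousLocalization.subsingleton (baseChangeGrading 𝒜 R')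
    (x := Submonoid.closure ((fun a ↦ (1 : R') ⊗ₜ[R] a) '' f.carrier))
    (Submonoid.subset_closure ⟨a, ha, h0⟩)
  exact (PrimeSpectrum.isEmpty_iff_subsingleton.mpr this).false (sq.isoPullback.inv t)

/-- The charts `U_(1 ⊗ f)` cover `Proj (R' ⊗[R] A)`. -/
lemma exists_chartι_baseChange_eq [AddGroup.FG M] (x : Proj (baseChangeGrading 𝒜 R')) :
    ∃ (f : FiniteRelevantFamily 𝒜) (h0 : ∀ a ∈ f.carrier, (1 : R') ⊗ₜ[R] a ≠ 0)
      (y : chart (baseChangeGrading 𝒜 R') (f.baseChange R' h0).carrier),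
      chartι (baseChangeGrading 𝒜 R') (f.baseChange R' h0) y = x := by
  obtain ⟨g, p, rfl⟩ := exists_chartι_eq x
  obtain ⟨f, h0, y, rfl⟩ := g.exists_baseChange_chartMap_eq R' p
  refine ⟨f, h0, chartMap _ Set.subset_union_right y, ?_⟩
  rw [← Scheme.Hom.comp_apply, ← Scheme.Hom.comp_apply,
    (isPullback_chartι g (f.baseChange R' h0)).w]

lemma hom_ext_chartι_baseChange [AddGroup.FG M] {Z : Scheme.{u}}
    {φ ψ : Proj (baseChangeGrading 𝒜 R') ⟶ Z}
    (h : ∀ (f : FiniteRelevantFamily 𝒜) (h0 : ∀ a ∈ f.carrier, (1 : R') ⊗ₜ[R] a ≠ 0),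
      chartι (baseChangeGrading 𝒜 R') (f.baseChange R' h0) ≫ φ =
        chartι (baseChangeGrading 𝒜 R') (f.baseChange R' h0) ≫ ψ) : φ = ψ :=
  Scheme.Cover.hom_ext (Scheme.Cover.mkOfCovers (P := @IsOpenImmersion)
    {f : FiniteRelevantFamily 𝒜 // ∀ a ∈ f.carrier, (1 : R') ⊗ₜ[R] a ≠ 0}
    (fun f ↦ chart (baseChangeGrading 𝒜 R') (f.1.baseChange R' f.2).carrier)
    (fun f ↦ chartι (baseChangeGrading 𝒜 R') (f.1.baseChange R' f.2))
    (fun x ↦ by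
      obtain ⟨f, h0, y, hy⟩ := exists_chartι_baseChange_eq R' x
      exact ⟨⟨f, h0⟩, y, hy⟩)) _ _ fun f ↦ h f.1 f.2

end MultiProj
end
theorem mainTheorem4 {M R A R' : Type u} [AddCommGroup M] [AddGroup.FG M] [DecidableEq M]
    [CommRing R] [CommRing A] [Algebra R A] [CommRing R'] [Algebra R R']
    (𝒜 : M → Submodule R A) [GradedAlgebra 𝒜] :
    ∃ e : MultiProj.Proj (MultiProj.baseChangeGrading 𝒜 R') ≅
        pullback (MultiProj.Proj.toSpec 𝒜) (Spec.map (CommRingCat.ofHom (algebraMap R R'))),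
      e.hom ≫ pullback.snd _ _ = MultiProj.Proj.toSpec (MultiProj.baseChangeGrading 𝒜 R') ∧
      ∀ (f : MultiProj.FiniteRelevantFamily 𝒜)
        (g : MultiProj.FiniteRelevantFamily (MultiProj.baseChangeGrading 𝒜 R'))
        (h : (fun a ↦ 1 ⊗ₜ[R] a) '' f.carrier = g.carrier),
        MultiProj.chartι (MultiProj.baseChangeGrading 𝒜 R') g ≫ e.hom ≫ pullback.fst _ _ =
          Spec.map (CommRingCat.ofHom (MultiProj.potionBaseChange R' h)) ≫
            MultiProj.chartι 𝒜 f := by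
  have (f : {f : MultiProj.FiniteRelevantFamily 𝒜 // ∀ a ∈ f.carrier, (1 : R') ⊗ₜ[R] a ≠ 0}) :
      IsOpenImmersion (MultiProj.chartToBaseChange R' f.1
        (f.1.baseChange_carrier R' f.2).symm) :=
    MultiProj.isOpenImmersion_chartToBaseChange _ _ _
  obtain ⟨e, he⟩ := Scheme.exists_iso_of_covers
    (ι := {f : MultiProj.FiniteRelevantFamily 𝒜 // ∀ a ∈ f.carrier, (1 : R') ⊗ₜ[R] a ≠ 0})
    (fun f ↦ MultiProj.chartι (MultiProj.baseChangeGrading 𝒜 R') (f.1.baseChange R' f.2))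
    (fun f ↦ MultiProj.chartToBaseChange R' f.1 (f.1.baseChange_carrier R' f.2).symm)
    (fun x ↦ by
      obtain ⟨f, h0, y, hy⟩ := MultiProj.exists_chartι_baseChange_eq R' x
      exact ⟨⟨f, h0⟩, y, hy⟩)
    (fun z ↦ by
      obtain ⟨f, h0, x, hx⟩ := MultiProj.exists_chartToBaseChange_eq R' z
      exact ⟨⟨f, h0⟩, x, hx⟩)
    _ _ (fun f f' ↦ MultiProj.isPullback_chartι _ _)
    (fun f f' ↦ MultiProj.isPullback_chartMap_chartToBaseChange R' f.1 _ f'.1 _)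
  have hchart (f : MultiProj.FiniteRelevantFamily 𝒜)
      (g : MultiProj.FiniteRelevantFamily (MultiProj.baseChangeGrading 𝒜 R'))
      (h : (fun a ↦ 1 ⊗ₜ[R] a) '' f.carrier = g.carrier) :
      MultiProj.chartι _ g ≫ e.hom = MultiProj.chartToBaseChange R' f h := by
    have h0 : ∀ a ∈ f.carrier, (1 : R') ⊗ₜ[R] a ≠ 0 := fun a ha ↦
      g.ne_zero _ (h ▸ Set.mem_image_of_mem _ ha)
    obtain rfl : g = f.baseChange R' h0 := MultiProj.FiniteRelevantFamily.ext h.symm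
    exact he ⟨f, h0⟩
  refine ⟨e, ?_, fun f g h ↦ ?_⟩
  · refine MultiProj.hom_ext_chartι_baseChange R' fun f h0 ↦ ?_
    rw [reassoc_of% hchart f _ (f.baseChange_carrier R' h0).symm,
      MultiProj.chartToBaseChange_snd, MultiProj.chartι_toSpec]
  · rw [reassoc_of% hchart f g h, MultiProj.chartToBaseChange_fst]
    rfl
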